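/- Let $(\Omega,\mathcal F,\mathbb P)$ be a probability space, and let $L^0$ be the Riesz space of real random variables modulo a.s. equality, with the a.s. order. Let $\varphi_0:L^\infty\to\mathbb R$ be a (finite) convex function with $\varphi_0(0)=0$ that is increasing ($X\le Y$ a.s. implies $\varphi_0(X)\le\varphi_0(Y)$) and has the Lebesgue property: $\varphi_0(X_n)\to\varphi_0(X)$ whenever $\sup_n\|X_n\|_\infty<\infty$ and $X_n\to X$ a.s. For $Z\in L^1$ and $X\in L^0$ with $X\ge 0$ put $$\varphi_0^*(Z)=\sup_{X\in L^\infty}\bigl(\mathbb E[XZ]-\varphi_0(X)\bigr),\qquad \hat\varphi(X)=\sup_{Z\in L^1,\ \varphi_0^*(Z)<\infty}\bigl(\mathbb E[XZ]-\varphi_0^*(Z)\bigr)\in[0,\infty]$$ (every $Z$ with $\varphi_0^*(Z)<\infty$ is a.s. nonnegative), and define $$M^{\hat\varphi}_u=\Bigl\{X\in L^0:\ \lim_{N\to\infty}\hat\varphi\bigl(\alpha|X|\mathbf 1_{\{|X|>N\}}\bigr)=0\ \text{ for all }\alpha>0\Bigr\},\qquad \|X\|_{\hat\varphi}=\inf\{\lambda>0:\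 \hat\varphi(|X|/\lambda)\le 1\}.$$ Assume that $\varphi_0$ is sensitive: for every $A\in\mathcal F$ with $\mathbb P(A)>0$ there is $\varepsilon>0$ with $\varphi_0(\varepsilon\mathbf 1_A)>0$. Then $(M^{\hat\varphi}_u,\|\cdot\|_{\hat\varphi})$ is an order-continuous Banach lattice. That is: $M^{\hat\varphi}_u$ is a solid vector subspace of $L^0$ (a vector subspace such that $|X|\le|Y|$ and $Y\in M^{\hat\varphi}_u$ imply $X\in M^{\hat\varphi}_u$); $\|\cdot\|_{\hat\varphi}$ is a finite norm on it with $\|X\|_{\hat\varphi}\le\|Y\|_{\hat\varphi}$ whenever $|X|\le|Y|$; $M^{\hat\varphi}_u$ is complete for this norm; and the norm is order-continuous, i.e. $\|X_n\|_{\hat\varphi}\to 0$ whenever $X_n\to 0$ a.s. and $|X_n|\le Y$ for all $n$ with some $Y\in M^{\hat\varphi}_u$, and also $\inf_{X\in D}\|X\|_{\hat\varphi}=0$ for every nonempty downward directed $D\subset M^{\hat\varphi}_u$ whose infimum in $M^{\hat\varphi}_u$ is $0$. -/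

import Mathlib

open MeasureTheory Filter Topology
open scoped ENNReal NNReal

noncomputable section

namespace LebesgueExtension

variable {Ω : Type*} [MeasurableSpace Ω] {μ : Measure Ω}

/-- The Lebesgue property of a function on `L^∞(μ)`: continuity along uniformly bounded,
almost surely convergent sequences. -/
def HasLebesgueProperty (φ₀ : Lp ℝ ∞ μ → ℝ) : Prop :=
  ∀ (X : ℕ → Lp ℝ ∞ μ) (Y : Lp ℝ ∞ μ),
    (∃ C : ℝ, ∀ n, ‖X n‖ ≤ C) →
    (∀ᵐ ω ∂μ, Tendsto (fun n => (X n : Ω → ℝ) ω) atTop (𝓝 ((Y : Ω → ℝ) ω))) →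
    Tendsto (fun n => φ₀ (X n)) atTop (𝓝 (φ₀ Y))

/-- Sensitivity: for every event `A` of positive probability there is `ε > 0` with
`φ₀ (ε 1_A) > 0`. -/
def IsSensitive [IsFiniteMeasure μ] (φ₀ : Lp ℝ ∞ μ → ℝ) : Prop :=
  ∀ (A : Set Ω) (hA : MeasurableSet A), 0 < μ A →
    ∃ ε : ℝ, 0 < ε ∧ 0 < φ₀ (indicatorConstLp ∞ hA (measure_ne_top μ A) ε)

/-- The conjugate `φ₀^*(Z) = sup_{X ∈ L^∞} (E[X Z] - φ₀(X))`, for `Z ∈ L^1`. The product `X Z` is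
integrable, so the Bochner integral is the expectation. -/
def conjugate (φ₀ : Lp ℝ ∞ μ → ℝ) (Z : Lp ℝ 1 μ) : EReal :=
  ⨆ X : Lp ℝ ∞ μ,
    (((∫ ω, (X : Ω → ℝ) ω * (Z : Ω → ℝ) ω ∂μ) - φ₀ X : ℝ) : EReal)

/-- The expectation `E[f] = E[f⁺] - E[f⁻]` in the extended reals; it is the usual one whenever
`E[f⁺]` or `E[f⁻]` is finite. -/
def extExpectation (μ : Measure Ω) (f : Ω → ℝ) : EReal :=
  ((∫⁻ ω, ENNReal.ofReal (f ω) ∂μ : ℝ≥0∞) : EReal)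
    - ((∫⁻ ω, ENNReal.ofReal (-f ω) ∂μ : ℝ≥0∞) : EReal)

/-- The extension `φ̂(X) = sup_{Z ∈ dom φ₀^*} (E[X Z] - φ₀^*(Z))`. It is meaningful for those
`X ∈ L^0` with `X⁻ Z ∈ L^1` for all `Z ∈ dom φ₀^*`, in particular for `X ≥ 0` (the elements of
`dom φ₀^*` are nonnegative); below it is evaluated only at nonnegative `X`. -/
def hatPhi (φ₀ : Lp ℝ ∞ μ → ℝ) (X : Ω →ₘ[μ] ℝ) : EReal :=
  ⨆ (Z : Lp ℝ 1 μ) (_ : conjugate φ₀ Z < ⊤),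
    extExpectation μ (fun ω => X ω * (Z : Ω → ℝ) ω) - conjugate φ₀ Z

/-- The tail `|X| 1_{|X| > N}` of `X ∈ L^0`. -/
def tail (N : ℕ) (X : Ω →ₘ[μ] ℝ) : Ω →ₘ[μ] ℝ :=
  AEEqFun.compMeasurable (fun x : ℝ => Set.indicator {y : ℝ | (N : ℝ) < |y|} (fun y => |y|) x)
    (measurable_norm.indicator (measurableSet_lt measurable_const measurable_norm)) X

/-- The Orlicz-type space
`M_u^φ̂ = {X ∈ L^0 : lim_N φ̂(α |X| 1_{|X| > N}) = 0 for all α > 0}`. -/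
def orliczU (φ₀ : Lp ℝ ∞ μ → ℝ) : Set (Ω →ₘ[μ] ℝ) :=
  {X | ∀ α : ℝ, 0 < α → Tendsto (fun N : ℕ => hatPhi φ₀ (α • tail N X)) atTop (𝓝 0)}

/-- The gauge `‖X‖_φ̂ = inf {r > 0 : φ̂(|X| / r) ≤ 1}`, with `inf ∅ = ∞`. -/
def gaugeNorm (φ₀ : Lp ℝ ∞ μ → ℝ) (X : Ω →ₘ[μ] ℝ) : ℝ≥0∞ :=
  ⨅ (r : ℝ≥0) (_ : 0 < r) (_ : hatPhi φ₀ ((r : ℝ)⁻¹ • |X|) ≤ 1), (r : ℝ≥0∞)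

/-- A solid (vector) subspace of `L^0`; such a space is a Riesz space for the operations and the
almost sure order inherited from `L^0`. -/
structure IsSolidSubspace (E : Set (Ω →ₘ[μ] ℝ)) : Prop where
  zero_mem : 0 ∈ E
  add_mem : ∀ X ∈ E, ∀ Y ∈ E, X + Y ∈ E
  smul_mem : ∀ (c : ℝ), ∀ X ∈ E, c • X ∈ E
  solid : ∀ (X : Ω →ₘ[μ] ℝ), ∀ Y ∈ E, |X| ≤ |Y| → X ∈ E

/-- `N` is a (finite) lattice norm on `E ⊆ L^0`. -/
structure IsLatticeNormOn (E : Set (Ω →ₘ[μ] ℝ)) (N : (Ω →ₘ[μ] ℝ) → ℝ≥0∞) : Prop where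
  finite : ∀ X ∈ E, N X < ⊤
  eq_zero_iff : ∀ X ∈ E, (N X = 0 ↔ X = 0)
  smul : ∀ (c : ℝ), ∀ X ∈ E, N (c • X) = ENNReal.ofReal |c| * N X
  add_le : ∀ X ∈ E, ∀ Y ∈ E, N (X + Y) ≤ N X + N Y
  mono : ∀ X ∈ E, ∀ Y ∈ E, |X| ≤ |Y| → N X ≤ N Y

/-- Every `N`-Cauchy sequence in `E` has an `N`-limit in `E`. -/
def IsCompleteFor (E : Set (Ω →ₘ[μ] ℝ)) (N : (Ω →ₘ[μ] ℝ) → ℝ≥0∞) : Prop :=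
  ∀ X : ℕ → (Ω →ₘ[μ] ℝ), (∀ n, X n ∈ E) →
    (∀ ε : ℝ≥0∞, 0 < ε → ∃ n₀ : ℕ, ∀ m ≥ n₀, ∀ n ≥ n₀, N (X m - X n) < ε) →
    ∃ Y ∈ E, Tendsto (fun n => N (X n - Y)) atTop (𝓝 0)

/-- Order continuity along sequences: `N (X n) → 0` whenever `|X n| ≤ Y ∈ E` and `X n → 0`
almost surely. -/
def IsSeqOrderContinuousOn (E : Set (Ω →ₘ[μ] ℝ)) (N : (Ω →ₘ[μ] ℝ) → ℝ≥0∞) : Prop :=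
  ∀ (X : ℕ → (Ω →ₘ[μ] ℝ)), ∀ Y ∈ E, (∀ n, X n ∈ E) → (∀ n, |X n| ≤ Y) →
    (∀ᵐ ω ∂μ, Tendsto (fun n => X n ω) atTop (𝓝 0)) →
    Tendsto (fun n => N (X n)) atTop (𝓝 0)

/-- Order continuity: `D ↓ 0` in the ordered space `E` implies `inf_{X ∈ D} N X = 0`, for every
nonempty downward directed `D ⊆ E` (equivalently, `N` tends to `0` along every net that decreases
to `0` in `E`, since a lattice norm is monotone on nonnegative elements). -/
def IsOrderContinuousOn (E : Set (Ω →ₘ[μ] ℝ)) (N : (Ω →ₘ[μ] ℝ) → ℝ≥0∞) : Prop :=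
  ∀ D ⊆ E, D.Nonempty → DirectedOn (fun X Y => Y ≤ X) D →
    (∀ X ∈ D, 0 ≤ X) → (∀ Y ∈ E, (∀ X ∈ D, Y ≤ X) → Y ≤ 0) →
    ⨅ X ∈ D, N X = 0

/-- `(E, N)`, with the vector and lattice structure inherited from `L^0`, is an order continuous
Banach lattice and a solid subspace of `L^0`. -/
structure IsOrderContinuousBanachLattice
    (E : Set (Ω →ₘ[μ] ℝ)) (N : (Ω →ₘ[μ] ℝ) → ℝ≥0∞) : Prop where
  solidSubspace : IsSolidSubspace E
  latticeNorm : IsLatticeNormOn E N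
  complete : IsCompleteFor E N
  seqOrderContinuous : IsSeqOrderContinuousOn E N
  orderContinuous : IsOrderContinuousOn E N

end LebesgueExtension

end

noncomputable section

namespace LebesgueExtension

variable {Ω : Type*} [MeasurableSpace Ω] {μ : Measure Ω}

/-! The gauge is a supremum of weighted `L^1`-norms. For `r > 0`, `φ̂(|X|/r) ≤ 1` says `E[|X| Z] ≤ r
(1 + φ₀^*(Z))` for every `Z ∈ dom φ₀^*`, so `‖X‖_φ̂ = sup_Z E[|X| Z] / (1 + φ₀^*(Z))`
(`gaugeNorm_eq`). Homogeneity, countable subadditivity and the Fatou property then come from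
integrals against a fixed `Z`.

The Fenchel–Young inequality transfers the Lebesgue property of `φ₀` to this norm along bounded
sequences tending to `0` (`tendsto_weightedNorm`). Membership in `M_u` means that the tails vanish
in norm (`mem_orliczU_iff`). Splitting at a level `N` into a bounded part and a tail therefore gives
finiteness of the norm and dominated convergence.

The converse half of duality is a Hahn–Banach argument in which the Lebesgue property forces the
supporting functionals into `L^1`. With sensitivity it shows that every non-null event is charged by
some `Z`. Hence finite norm implies a.s. finiteness and zero norm implies a.s. vanishing, and
completeness follows as in Riesz–Fischer. Order continuity for directed sets reduces to sequences.
-/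

/-! ### Functionals on `L^∞` with the Lebesgue property -/

lemma ae_norm_le_norm (X : Lp ℝ ∞ μ) : ∀ᵐ ω ∂μ, ‖(X : Ω → ℝ) ω‖ ≤ ‖X‖ := by
  filter_upwards [ae_le_eLpNormEssSup (f := (X : Ω → ℝ)) (μ := μ)] with ω hω
  rw [Lp.norm_def, eLpNorm_exponent_top, ← toReal_enorm]
  refine ENNReal.toReal_mono ?_ hω
  rw [← eLpNorm_exponent_top]
  exact Lp.eLpNorm_ne_top X

lemma norm_le_of_ae_bound [IsFiniteMeasure μ] {X : Lp ℝ ∞ μ} {C : ℝ} (hC : 0 ≤ C)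
    (h : ∀ᵐ ω ∂μ, ‖(X : Ω → ℝ) ω‖ ≤ C) : ‖X‖ ≤ C := by
  simpa using Lp.norm_le_of_ae_bound hC h

lemma HasLebesgueProperty.tendsto_toLp [IsFiniteMeasure μ] {φ₀ : Lp ℝ ∞ μ → ℝ}
    (hLeb : HasLebesgueProperty φ₀) {F : ℕ → Ω → ℝ} {f : Ω → ℝ} (hF : ∀ n, MemLp (F n) ∞ μ)
    (hf : MemLp f ∞ μ) {C : ℝ} (hC : 0 ≤ C) (hFC : ∀ n, ∀ᵐ ω ∂μ, ‖F n ω‖ ≤ C)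
    (hlim : ∀ᵐ ω ∂μ, Tendsto (fun n => F n ω) atTop (𝓝 (f ω))) :
    Tendsto (fun n => φ₀ ((hF n).toLp)) atTop (𝓝 (φ₀ hf.toLp)) := by
  refine hLeb _ _ ⟨C, fun n => norm_le_of_ae_bound hC ?_⟩ ?_
  · filter_upwards [(hF n).coeFn_toLp, hFC n] with ω h1 h2
    rwa [h1]
  · filter_upwards [ae_all_iff.2 fun n => (hF n).coeFn_toLp, hf.coeFn_toLp, hlim] with ω h1 h2 h3
    simpa only [h1, h2] using h3

lemma HasLebesgueProperty.continuous {φ₀ : Lp ℝ ∞ μ → ℝ} (hLeb : HasLebesgueProperty φ₀) :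
    Continuous φ₀ := by
  refine continuous_iff_seqContinuous.2 fun X Y hXY => ?_
  refine hLeb X Y ?_ ?_
  · obtain ⟨C, hC⟩ := hXY.norm.bddAbove_range
    exact ⟨C, fun n => hC ⟨n, rfl⟩⟩
  · filter_upwards [ae_all_iff.2 fun n => ae_norm_le_norm (X n - Y),
      ae_all_iff.2 fun n => Lp.coeFn_sub (X n) Y] with ω h1 h2
    rw [tendsto_iff_norm_sub_tendsto_zero]
    refine squeeze_zero (fun _ => norm_nonneg _) (fun n => ?_)
      (tendsto_iff_norm_sub_tendsto_zero.1 hXY)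
    have := h1 n
    rwa [h2 n] at this

/-- A linear minorant, up to a constant, of a function with the Lebesgue property is continuous
along bounded almost surely convergent sequences. -/
lemma HasLebesgueProperty.tendsto_linear {φ₀ : Lp ℝ ∞ μ → ℝ} (hLeb : HasLebesgueProperty φ₀)
    (hzero : φ₀ 0 = 0) (l : Lp ℝ ∞ μ →L[ℝ] ℝ) (c : ℝ) (hl : ∀ X, l X + c ≤ φ₀ X)
    {X : ℕ → Lp ℝ ∞ μ} {Y : Lp ℝ ∞ μ} {C : ℝ} (hC : ∀ n, ‖X n‖ ≤ C)
    (hlim : ∀ᵐ ω ∂μ, Tendsto (fun n => (X n : Ω → ℝ) ω) atTop (𝓝 ((Y : Ω → ℝ) ω))) :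
    Tendsto (fun n => l (X n)) atTop (𝓝 (l Y)) := by
  -- The minorant gives `t (l (X n) - l Y) + c ≤ φ₀ (t (X n - Y))`, and the right side tends to `0`.
  -- As `t` is an arbitrary real, large `t` of both signs squeeze `l (X n) - l Y` to `0`.
  have key (t : ℝ) : ∀ᶠ n in atTop, t * (l (X n) - l Y) < |c| + 1 := by
    have h : Tendsto (fun n => φ₀ (t • (X n - Y))) atTop (𝓝 (φ₀ 0)) := by
      refine hLeb _ _ ⟨|t| * (C + ‖Y‖), fun n => ?_⟩ ?_
      · rw [norm_smul, Real.norm_eq_abs]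
        gcongr
        exact (norm_sub_le _ _).trans (by gcongr; exact hC n)
      · filter_upwards [ae_all_iff.2 fun n => Lp.coeFn_smul t (X n - Y),
          ae_all_iff.2 fun n => Lp.coeFn_sub (X n) Y, Lp.coeFn_zero ℝ ∞ μ, hlim] with ω h1 h2 h3 h4
        simp only [h1, h3, Pi.smul_apply, h2, Pi.sub_apply, Pi.zero_apply, smul_eq_mul]
        simpa using (h4.sub_const ((Y : Ω → ℝ) ω)).const_mul t
    rw [hzero] at h
    filter_upwards [h.eventually (gt_mem_nhds one_pos)] with n hn
    have := hl (t • (X n - Y))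
    simp only [map_smul, map_sub, smul_eq_mul] at this
    linarith [neg_abs_le c]
  rw [Metric.tendsto_nhds]
  intro ε hε
  have hc : 0 < |c| + 1 := by positivity
  filter_upwards [key ((|c| + 1) / ε), key (-((|c| + 1) / ε))] with n h1 h2
  rw [Real.dist_eq, abs_lt]
  have hd : 0 < (|c| + 1) / ε := by positivity
  have e : (|c| + 1) / ε * ε = |c| + 1 := by field_simp
  constructor
  · by_contra! h
    nlinarith
  · by_contra! h
    nlinarith

/-- A continuous linear functional on `L^∞` that is continuous along bounded almost surely
convergent sequences is represented by an element of `L^1`. -/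
lemma exists_integral_representation [IsFiniteMeasure μ] (l : Lp ℝ ∞ μ →L[ℝ] ℝ)
    (hl : ∀ (X : ℕ → Lp ℝ ∞ μ) (Y : Lp ℝ ∞ μ) (C : ℝ), (∀ n, ‖X n‖ ≤ C) →
      (∀ᵐ ω ∂μ, Tendsto (fun n => (X n : Ω → ℝ) ω) atTop (𝓝 ((Y : Ω → ℝ) ω))) →
      Tendsto (fun n => l (X n)) atTop (𝓝 (l Y))) :
    ∃ Z : Lp ℝ 1 μ, ∀ X : Lp ℝ ∞ μ, l X = ∫ ω, (X : Ω → ℝ) ω * (Z : Ω → ℝ) ω ∂μ := by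
  classical
  have htoLp {F : ℕ → Ω → ℝ} {f : Ω → ℝ} (hF : ∀ n, MemLp (F n) ∞ μ)
      (hf : MemLp f ∞ μ) {C : ℝ} (hC : 0 ≤ C) (hFC : ∀ n, ∀ᵐ ω ∂μ, ‖F n ω‖ ≤ C)
      (hlim : ∀ᵐ ω ∂μ, Tendsto (fun n => F n ω) atTop (𝓝 (f ω))) :
      Tendsto (fun n => l ((hF n).toLp)) atTop (𝓝 (l hf.toLp)) := by
    refine hl _ _ C (fun n => norm_le_of_ae_bound hC ?_) ?_
    · filter_upwards [(hF n).coeFn_toLp, hFC n] with ω h1 h2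
      rwa [h1]
    · filter_upwards [ae_all_iff.2 fun n => (hF n).coeFn_toLp, hf.coeFn_toLp, hlim] with ω h1 h2 h3
      simpa only [h1, h2] using h3
  -- `A ↦ l 1_A` is a signed measure absolutely continuous with respect to `μ`; its Radon–Nikodym
  -- density is the required `Z`.
  let v : Set Ω → ℝ := fun A => if hA : MeasurableSet A then
    l (indicatorConstLp ∞ hA (measure_ne_top μ A) (1 : ℝ)) else 0
  have v_def {A : Set Ω} (hA : MeasurableSet A) :
    v A = l (indicatorConstLp ∞ hA (measure_ne_top μ A) (1 : ℝ)) := dif_pos hA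
  have v_null {A : Set Ω} (hA : MeasurableSet A) (h0 : μ A = 0) : v A = 0 := by
    rw [v_def hA]
    have : indicatorConstLp ∞ hA (measure_ne_top μ A) (1 : ℝ) = 0 := by
      rw [Lp.eq_zero_iff_ae_eq_zero]
      filter_upwards [indicatorConstLp_coeFn (p := ∞) (hs := hA) (hμs := measure_ne_top μ A)
        (c := (1 : ℝ)), measure_eq_zero_iff_ae_notMem.1 h0] with ω h1 h2
      simp [h1, h2]
    rw [this, map_zero]
  have v_union {A B : Set Ω} (hA : MeasurableSet A) (hB : MeasurableSet B) (h : Disjoint A B) :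
      v (A ∪ B) = v A + v B := by
    rw [v_def hA, v_def hB, v_def (hA.union hB), ← map_add,
      indicatorConstLp_disjoint_union hA hB _ _ h]
  let s : SignedMeasure Ω :=
    { measureOf' := v
      empty' := v_null .empty (by simp)
      not_measurable' := fun A hA => dif_neg hA
      m_iUnion' := by
        intro A hA hd
        have hm (t : Finset ℕ) : MeasurableSet (⋃ i ∈ t, A i) :=
          Finset.measurableSet_biUnion _ fun i _ => hA i
        have hfin (t : Finset ℕ) : v (⋃ i ∈ t, A i) = ∑ i ∈ t, v (A i) := by
          induction t using Finset.induction_on with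
          | empty => simpa using v_null .empty (by simp)
          | insert n t hn ih =>
            rw [Finset.sum_insert hn, ← ih, ← v_union (hA n) (hm t), Finset.set_biUnion_insert]
            rw [Set.disjoint_iUnion₂_right]
            exact fun i hi => hd fun h => hn (h ▸ hi)
        -- Unconditional summation is tested along sequences of finite sets tending to `atTop`. The
        -- indicators of the partial unions are then eventually constant at each point, so the
        -- sequential continuity of `l` applies.
        refine tendsto_of_seq_tendsto fun t ht => ?_
        simp only [SummationFilter.unconditional_filter] at ht
        simp only [Function.comp_def, ← hfin, v_def (hm _), v_def (MeasurableSet.iUnion hA)]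
        refine htoLp _ _ zero_le_one (fun n => ae_of_all _ fun ω => ?_) (ae_of_all _ fun ω => ?_)
        · exact (norm_indicator_le_norm_self _ _).trans (by simp)
        · refine tendsto_const_nhds.congr' ?_
          by_cases hω : ω ∈ ⋃ i, A i
          · obtain ⟨i, hi⟩ := Set.mem_iUnion.1 hω
            filter_upwards [ht.eventually (eventually_ge_atTop {i})] with n hn
            rw [Set.indicator_of_mem hω, Set.indicator_of_mem]
            exact Set.mem_biUnion (Finset.mem_coe.2 (Finset.singleton_subset_iff.1 hn)) hi
          · refine Eventually.of_forall fun n => ?_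
            have : ω ∉ ⋃ i ∈ t n, A i := fun h => hω (Set.iUnion₂_subset_iUnion _ _ h)
            simp only [Set.indicator_of_notMem hω, Set.indicator_of_notMem this] }
  have hs : s ≪ᵥ μ.toENNRealVectorMeasure := by
    refine VectorMeasure.AbsolutelyContinuous.mk fun A hA h => ?_
    rw [Measure.toENNRealVectorMeasure_apply_measurable hA] at h
    exact v_null hA h
  have hrn := (SignedMeasure.absolutelyContinuous_iff_withDensityᵥ_rnDeriv_eq s μ).1 hs
  have hint := SignedMeasure.integrable_rnDeriv s μ
  set z := s.rnDeriv μ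
  have hset {A : Set Ω} (hA : MeasurableSet A) : v A = ∫ ω in A, z ω ∂μ := by
    rw [← withDensityᵥ_apply hint hA, hrn]; rfl
  have hmul (f : SimpleFunc Ω ℝ) : Integrable (fun ω => f ω * z ω) μ := by
    obtain ⟨C, hC⟩ := f.exists_forall_norm_le
    exact hint.bdd_mul f.aestronglyMeasurable (ae_of_all _ hC)
  have hsimple (f : SimpleFunc Ω ℝ) : ∀ hf : MemLp f ∞ μ, l hf.toLp = ∫ ω, f ω * z ω ∂μ := by
    induction f using SimpleFunc.induction with
    | const c hA =>
      rename_i A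
      intro hf
      have : hf.toLp = c • indicatorConstLp ∞ hA (measure_ne_top μ A) (1 : ℝ) := by
        ext1
        filter_upwards [hf.coeFn_toLp, indicatorConstLp_coeFn (p := ∞) (hs := hA)
          (hμs := measure_ne_top μ A) (c := (1 : ℝ)), Lp.coeFn_smul c
          (indicatorConstLp ∞ hA (measure_ne_top μ A) (1 : ℝ))] with ω h1 h2 h3
        rw [h1, h3, Pi.smul_apply, h2]
        by_cases hω : ω ∈ A <;> simp [hω]
      rw [this, map_smul, ← v_def hA, hset hA, smul_eq_mul, ← integral_const_mul,
        ← integral_indicator hA]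
      refine integral_congr_ae (ae_of_all _ fun ω => ?_)
      by_cases hω : ω ∈ A <;> simp [hω]
    | add hfg hf' hg' =>
      rename_i f g
      intro h
      have hf := f.memLp_top μ
      have hg := g.memLp_top μ
      have : h.toLp = hf.toLp + hg.toLp := (MemLp.toLp_congr _ (hf.add hg) (by simp)).trans
        (MemLp.toLp_add hf hg)
      rw [this, map_add, hf' hf, hg' hg, ← integral_add (hmul f) (hmul g)]
      exact integral_congr_ae (ae_of_all _ fun ω => by simp [add_mul])
  refine ⟨(memLp_one_iff_integrable.2 hint).toLp, fun X => ?_⟩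
  -- Simple functions bounded by `‖X‖` approximate `X` almost surely. Both sides of the identity
  -- pass to the limit, the left by hypothesis and the right by dominated convergence.
  have hX := Lp.stronglyMeasurable X
  have hF (n : ℕ) := (hX.approxBounded ‖X‖ n).memLp_top μ
  have hb (n : ℕ) (ω : Ω) : ‖hX.approxBounded ‖X‖ n ω‖ ≤ ‖X‖ :=
    hX.norm_approxBounded_le (norm_nonneg _) n ω
  have hlim := hX.tendsto_approxBounded_ae (ae_norm_le_norm X)
  have h1 := htoLp hF (Lp.memLp X) (norm_nonneg X) (fun n => ae_of_all _ (hb n)) hlim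
  simp only [hsimple, Lp.toLp_coeFn] at h1
  have h2 : Tendsto (fun n => ∫ ω, hX.approxBounded ‖X‖ n ω * z ω ∂μ) atTop
      (𝓝 (∫ ω, (X : Ω → ℝ) ω * z ω ∂μ)) := by
    refine tendsto_integral_of_dominated_convergence (fun ω => ‖X‖ * ‖z ω‖)
      (fun n => (hF n).1.mul hint.1) (hint.norm.const_mul _) (fun n => ae_of_all _ fun ω => ?_) ?_
    · rw [norm_mul]
      gcongr
      exact hb n ω
    · filter_upwards [hlim] with ω hω using hω.mul_const _
  rw [tendsto_nhds_unique h1 h2]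
  refine integral_congr_ae ?_
  filter_upwards [(memLp_one_iff_integrable.2 hint).coeFn_toLp] with ω h
  rw [h]

/-! ### The conjugate and Fenchel duality -/

section Conjugate

variable {φ₀ : Lp ℝ ∞ μ → ℝ}

lemma integrable_mul (X : Lp ℝ ∞ μ) (Z : Lp ℝ 1 μ) :
    Integrable (fun ω => (X : Ω → ℝ) ω * (Z : Ω → ℝ) ω) μ :=
  (L1.integrable_coeFn Z).bdd_mul (Lp.aestronglyMeasurable X) (ae_norm_le_norm X)

lemma le_conjugate (φ₀ : Lp ℝ ∞ μ → ℝ) (X : Lp ℝ ∞ μ) (Z : Lp ℝ 1 μ) :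
    (((∫ ω, (X : Ω → ℝ) ω * (Z : Ω → ℝ) ω ∂μ) - φ₀ X : ℝ) : EReal) ≤ conjugate φ₀ Z :=
  le_iSup (fun X : Lp ℝ ∞ μ =>
    (((∫ ω, (X : Ω → ℝ) ω * (Z : Ω → ℝ) ω ∂μ) - φ₀ X : ℝ) : EReal)) X

lemma integral_zero_mul (Z : Lp ℝ 1 μ) :
    ∫ ω, ((0 : Lp ℝ ∞ μ) : Ω → ℝ) ω * (Z : Ω → ℝ) ω ∂μ = 0 := by
  refine integral_eq_zero_of_ae ?_
  filter_upwards [Lp.coeFn_zero ℝ ∞ μ] with ω h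
  rw [h, Pi.zero_apply, zero_mul]

lemma conjugate_nonneg (hzero : φ₀ 0 = 0) (Z : Lp ℝ 1 μ) : 0 ≤ conjugate φ₀ Z := by
  refine le_trans (le_of_eq ?_) (le_conjugate φ₀ 0 Z)
  rw [integral_zero_mul, hzero, sub_zero, EReal.coe_zero]

lemma coe_toReal_conjugate (hzero : φ₀ 0 = 0) {Z : Lp ℝ 1 μ} (hZ : conjugate φ₀ Z < ⊤) :
    (((conjugate φ₀ Z).toReal : ℝ) : EReal) = conjugate φ₀ Z :=
  EReal.coe_toReal hZ.ne (ne_bot_of_le_ne_bot EReal.zero_ne_bot (conjugate_nonneg hzero Z))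

lemma integral_sub_le_toReal_conjugate (hzero : φ₀ 0 = 0) {Z : Lp ℝ 1 μ}
    (hZ : conjugate φ₀ Z < ⊤) (X : Lp ℝ ∞ μ) :
    (∫ ω, (X : Ω → ℝ) ω * (Z : Ω → ℝ) ω ∂μ) - φ₀ X ≤ (conjugate φ₀ Z).toReal := by
  rw [← EReal.coe_le_coe_iff, coe_toReal_conjugate hzero hZ]
  exact le_conjugate φ₀ X Z

/-- The dual representation of a convex function with the Lebesgue property. -/
lemma exists_lt_integral_sub_conjugate [IsFiniteMeasure μ] (hconv : ConvexOn ℝ Set.univ φ₀)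
    (hLeb : HasLebesgueProperty φ₀) (hzero : φ₀ 0 = 0) {X : Lp ℝ ∞ μ} {a : ℝ} (ha : a < φ₀ X) :
    ∃ Z : Lp ℝ 1 μ, conjugate φ₀ Z < ⊤ ∧
      a ≤ (∫ ω, (X : Ω → ℝ) ω * (Z : Ω → ℝ) ω ∂μ) - (conjugate φ₀ Z).toReal := by
  obtain ⟨l, c, hle, heq⟩ := ConvexOn.exists_affine_le_of_lt (𝕜 := ℝ) (Set.mem_univ X) ha
    isClosed_univ (hLeb.continuous.lowerSemicontinuous.lowerSemicontinuousOn _) hconv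
  replace hle (Y : Lp ℝ ∞ μ) : l Y + c ≤ φ₀ Y := hle ⟨Y, Set.mem_univ Y⟩
  replace heq : l X + c = a := heq
  obtain ⟨Z, hZ⟩ := exists_integral_representation l fun Y W C hC hlim =>
    hLeb.tendsto_linear hzero l c hle hC hlim
  have hcZ : conjugate φ₀ Z ≤ ((-c : ℝ) : EReal) := by
    refine iSup_le fun Y => ?_
    rw [EReal.coe_le_coe_iff, ← hZ]
    linarith [hle Y]
  have htop : conjugate φ₀ Z < ⊤ := hcZ.trans_lt (EReal.coe_lt_top _)
  refine ⟨Z, htop, ?_⟩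
  rw [← coe_toReal_conjugate hzero htop, EReal.coe_le_coe_iff] at hcZ
  rw [← hZ]
  linarith

/-- If `∫_A Z < 0`, the test variables `-t 1_A` have `φ₀ ≤ 0` by monotonicity, while their pairing
with `Z` grows without bound in `t`. -/
lemma ae_nonneg_of_conjugate_lt_top [IsFiniteMeasure μ] (hmono : Monotone φ₀) (hzero : φ₀ 0 = 0)
    {Z : Lp ℝ 1 μ} (hZ : conjugate φ₀ Z < ⊤) : 0 ≤ᵐ[μ] (Z : Ω → ℝ) := by
  refine ae_nonneg_of_forall_setIntegral_nonneg (L1.integrable_coeFn Z) fun A hA _ => ?_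
  by_contra! hneg
  obtain ⟨t, ht⟩ := exists_nat_gt
    ((conjugate φ₀ Z).toReal / -(∫ ω in A, (Z : Ω → ℝ) ω ∂μ))
  rw [div_lt_iff₀ (by linarith)] at ht
  set I := indicatorConstLp ∞ hA (measure_ne_top μ A) (-(t : ℝ))
  have hIc : I =ᵐ[μ] A.indicator fun _ => -(t : ℝ) := indicatorConstLp_coeFn
  have h1 : φ₀ I ≤ 0 := by
    rw [← hzero]
    refine hmono ?_
    rw [← Lp.coeFn_le]
    filter_upwards [hIc, Lp.coeFn_zero ℝ ∞ μ] with ω h1 h2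
    rw [h1, h2]
    by_cases hω : ω ∈ A <;> simp [hω]
  have h2 : ∫ ω, (I : Ω → ℝ) ω * (Z : Ω → ℝ) ω ∂μ = -t * ∫ ω in A, (Z : Ω → ℝ) ω ∂μ := by
    rw [← integral_const_mul, ← integral_indicator hA]
    refine integral_congr_ae ?_
    filter_upwards [hIc] with ω h
    rw [h]
    by_cases hω : ω ∈ A <;> simp [hω]
  have := integral_sub_le_toReal_conjugate hzero hZ I
  rw [h2] at this
  linarith

lemma extExpectation_eq {f : Ω → ℝ} (hf : 0 ≤ᵐ[μ] f) :
    extExpectation μ f = ((∫⁻ ω, ‖f ω‖ₑ ∂μ : ℝ≥0∞) : EReal) := by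
  have h1 : ∫⁻ ω, ENNReal.ofReal (-f ω) ∂μ = 0 := by
    rw [lintegral_congr_ae (g := fun _ => 0), lintegral_zero]
    filter_upwards [hf] with ω h
    simpa using h
  have h2 : ∫⁻ ω, ENNReal.ofReal (f ω) ∂μ = ∫⁻ ω, ‖f ω‖ₑ ∂μ := by
    refine lintegral_congr_ae ?_
    filter_upwards [hf] with ω h
    exact (Real.enorm_of_nonneg h).symm
  simp [extExpectation, h1, h2]

/-- The penalty `φ₀^*(Z)` as an extended nonnegative real. -/
def penalty (φ₀ : Lp ℝ ∞ μ → ℝ) (Z : Lp ℝ 1 μ) : ℝ≥0∞ := (conjugate φ₀ Z).toENNReal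

lemma coe_penalty (hzero : φ₀ 0 = 0) (Z : Lp ℝ 1 μ) :
    ((penalty φ₀ Z : ℝ≥0∞) : EReal) = conjugate φ₀ Z :=
  EReal.coe_toENNReal (conjugate_nonneg hzero Z)

lemma penalty_eq_ofReal {Z : Lp ℝ 1 μ} (hZ : conjugate φ₀ Z < ⊤) :
    penalty φ₀ Z = ENNReal.ofReal (conjugate φ₀ Z).toReal :=
  EReal.toENNReal_of_ne_top hZ.ne

lemma penalty_ne_top {Z : Lp ℝ 1 μ} (hZ : conjugate φ₀ Z < ⊤) : penalty φ₀ Z ≠ ∞ := by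
  simp [penalty_eq_ofReal hZ]

/-- Moving the finite penalty across removes the subtraction, so later estimates can be made in
`ℝ≥0∞`. -/
lemma hatPhi_le_iff [IsFiniteMeasure μ] (hmono : Monotone φ₀) (hzero : φ₀ 0 = 0)
    {X : Ω →ₘ[μ] ℝ} (hX : 0 ≤ᵐ[μ] X) (a : ℝ≥0∞) :
    hatPhi φ₀ X ≤ a ↔ ∀ Z : Lp ℝ 1 μ, conjugate φ₀ Z < ⊤ →
      ∫⁻ ω, ‖X ω‖ₑ * ‖(Z : Ω → ℝ) ω‖ₑ ∂μ ≤ a + penalty φ₀ Z := by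
  refine iSup₂_le_iff.trans (forall₂_congr fun Z hZ => ?_)
  have hpos : 0 ≤ᵐ[μ] fun ω => X ω * (Z : Ω → ℝ) ω := by
    filter_upwards [hX, ae_nonneg_of_conjugate_lt_top hmono hzero hZ] with ω h1 h2
    exact mul_nonneg h1 h2
  rw [extExpectation_eq hpos, ← coe_penalty hzero, EReal.sub_le_iff_le_add (.inl (by simp))
    (.inl (by simpa using penalty_ne_top hZ)), ← EReal.coe_ennreal_add,
    EReal.coe_ennreal_le_coe_ennreal_iff]
  simp_rw [enorm_mul]

/-- The dual representation at `0` yields `Z` with arbitrarily small penalty. -/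
lemma hatPhi_nonneg [IsFiniteMeasure μ] (hmono : Monotone φ₀) (hconv : ConvexOn ℝ Set.univ φ₀)
    (hLeb : HasLebesgueProperty φ₀) (hzero : φ₀ 0 = 0) {X : Ω →ₘ[μ] ℝ} (hX : 0 ≤ᵐ[μ] X) :
    0 ≤ hatPhi φ₀ X := by
  by_contra! hneg
  obtain ⟨a, hXa, ha⟩ := EReal.lt_iff_exists_real_btwn.1 hneg
  have ha' : a < φ₀ 0 := by rw [hzero]; exact_mod_cast ha
  obtain ⟨Z, hZ, h⟩ := exists_lt_integral_sub_conjugate hconv hLeb hzero ha'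
  rw [integral_zero_mul, zero_sub] at h
  have hpos : 0 ≤ᵐ[μ] fun ω => X ω * (Z : Ω → ℝ) ω := by
    filter_upwards [hX, ae_nonneg_of_conjugate_lt_top hmono hzero hZ] with ω h1 h2
    exact mul_nonneg h1 h2
  refine hXa.not_ge (le_trans ?_ (le_iSup₂ (f := fun (Z : Lp ℝ 1 μ) (_ : conjugate φ₀ Z < ⊤) =>
    extExpectation μ (fun ω => X ω * (Z : Ω → ℝ) ω) - conjugate φ₀ Z) Z hZ))
  rw [extExpectation_eq hpos]
  calc (a : EReal) ≤ 0 - conjugate φ₀ Z := by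
        rw [← coe_toReal_conjugate hzero hZ, zero_sub]; exact_mod_cast h
    _ ≤ _ := EReal.sub_le_sub (EReal.coe_ennreal_nonneg _) le_rfl

/-- The Fenchel–Young inequality, in the form needed for weighted norms. -/
lemma lintegral_le_add_penalty [IsFiniteMeasure μ] (hzero : φ₀ 0 = 0) (hmono : Monotone φ₀)
    {Z : Lp ℝ 1 μ} (hZ : conjugate φ₀ Z < ⊤) {F : Ω → ℝ} (hF : MemLp F ∞ μ) (hF0 : 0 ≤ᵐ[μ] F) :
    ∫⁻ ω, ‖F ω‖ₑ * ‖(Z : Ω → ℝ) ω‖ₑ ∂μ ≤ ENNReal.ofReal (φ₀ hF.toLp) + penalty φ₀ Z := by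
  have h := integral_sub_le_toReal_conjugate hzero hZ hF.toLp
  have hpos : 0 ≤ᵐ[μ] fun ω => (hF.toLp : Ω → ℝ) ω * (Z : Ω → ℝ) ω := by
    filter_upwards [hF0, hF.coeFn_toLp, ae_nonneg_of_conjugate_lt_top hmono hzero hZ] with ω h1 h2 h3
    rw [h2]
    exact mul_nonneg h1 h3
  have e : ∫⁻ ω, ‖F ω‖ₑ * ‖(Z : Ω → ℝ) ω‖ₑ ∂μ =
      ENNReal.ofReal (∫ ω, (hF.toLp : Ω → ℝ) ω * (Z : Ω → ℝ) ω ∂μ) := by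
    rw [ofReal_integral_eq_lintegral_ofReal (integrable_mul _ _) hpos]
    refine lintegral_congr_ae ?_
    filter_upwards [hpos, hF.coeFn_toLp] with ω h1 h2
    rw [← Real.enorm_of_nonneg h1, enorm_mul, h2]
  rw [e, penalty_eq_ofReal hZ]
  exact (ENNReal.ofReal_le_ofReal (by linarith)).trans ENNReal.ofReal_add_le

end Conjugate

/-! ### The weighted `L^1`-norm -/

section WeightedNorm

variable {φ₀ : Lp ℝ ∞ μ → ℝ} {f g : Ω → ℝ≥0∞}

/-- The supremum of the weighted `L^1`-norms `E[f |Z|] / (1 + φ₀^*(Z))` over `dom φ₀^*`. It agrees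
with the gauge norm. -/
def weightedNorm (φ₀ : Lp ℝ ∞ μ → ℝ) (f : Ω → ℝ≥0∞) : ℝ≥0∞ :=
  ⨆ (Z : Lp ℝ 1 μ) (_ : conjugate φ₀ Z < ⊤),
    (∫⁻ ω, f ω * ‖(Z : Ω → ℝ) ω‖ₑ ∂μ) / (1 + penalty φ₀ Z)

lemma weightedNorm_le_iff {r : ℝ≥0∞} :
    weightedNorm φ₀ f ≤ r ↔ ∀ Z : Lp ℝ 1 μ, conjugate φ₀ Z < ⊤ →
      ∫⁻ ω, f ω * ‖(Z : Ω → ℝ) ω‖ₑ ∂μ ≤ r * (1 + penalty φ₀ Z) := by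
  refine iSup₂_le_iff.trans (forall₂_congr fun Z hZ => ?_)
  exact ENNReal.div_le_iff (by simp) (ENNReal.add_ne_top.2 ⟨by simp, penalty_ne_top hZ⟩)

lemma lintegral_le_weightedNorm_mul (f : Ω → ℝ≥0∞) {Z : Lp ℝ 1 μ} (hZ : conjugate φ₀ Z < ⊤) :
    ∫⁻ ω, f ω * ‖(Z : Ω → ℝ) ω‖ₑ ∂μ ≤ weightedNorm φ₀ f * (1 + penalty φ₀ Z) :=
  weightedNorm_le_iff.1 le_rfl Z hZ

lemma weightedNorm_mono (h : f ≤ᵐ[μ] g) : weightedNorm φ₀ f ≤ weightedNorm φ₀ g := by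
  refine iSup₂_mono fun Z _ => ?_
  gcongr ?_ / _
  refine lintegral_mono_ae ?_
  filter_upwards [h] with ω hω
  gcongr

lemma weightedNorm_congr (h : f =ᵐ[μ] g) : weightedNorm φ₀ f = weightedNorm φ₀ g :=
  (weightedNorm_mono h.le).antisymm (weightedNorm_mono h.symm.le)

@[simp] lemma weightedNorm_zero : weightedNorm φ₀ (fun _ => 0) = 0 := by
  simp [weightedNorm]

lemma aemeasurable_enorm_coe (Z : Lp ℝ 1 μ) : AEMeasurable (fun ω => ‖(Z : Ω → ℝ) ω‖ₑ) μ :=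
  (Lp.aestronglyMeasurable Z).enorm

lemma aemeasurable_mul_enorm_coe (hf : AEMeasurable f μ) (Z : Lp ℝ 1 μ) :
    AEMeasurable (fun ω => f ω * ‖(Z : Ω → ℝ) ω‖ₑ) μ :=
  hf.mul (aemeasurable_enorm_coe Z)

lemma weightedNorm_const_mul {c : ℝ≥0∞} (hc : c ≠ ∞) (f : Ω → ℝ≥0∞) :
    weightedNorm φ₀ (fun ω => c * f ω) = c * weightedNorm φ₀ f := by
  simp_rw [weightedNorm, ENNReal.mul_iSup, mul_assoc, lintegral_const_mul' c _ hc, mul_div_assoc]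

lemma weightedNorm_add_le (hf : AEMeasurable f μ) (g : Ω → ℝ≥0∞) :
    weightedNorm φ₀ (fun ω => f ω + g ω) ≤ weightedNorm φ₀ f + weightedNorm φ₀ g := by
  refine weightedNorm_le_iff.2 fun Z hZ => ?_
  simp_rw [add_mul]
  rw [lintegral_add_left' (aemeasurable_mul_enorm_coe hf Z)]
  exact add_le_add (lintegral_le_weightedNorm_mul f hZ) (lintegral_le_weightedNorm_mul g hZ)

lemma weightedNorm_tsum_le {f : ℕ → Ω → ℝ≥0∞} (hf : ∀ n, AEMeasurable (f n) μ) :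
    weightedNorm φ₀ (fun ω => ∑' n, f n ω) ≤ ∑' n, weightedNorm φ₀ (f n) := by
  refine weightedNorm_le_iff.2 fun Z hZ => ?_
  simp_rw [← ENNReal.tsum_mul_right]
  rw [lintegral_tsum fun n => aemeasurable_mul_enorm_coe (hf n) Z]
  exact ENNReal.tsum_le_tsum fun n => lintegral_le_weightedNorm_mul (f n) hZ

/-- Fatou's lemma for each fixed `Z`. -/
lemma weightedNorm_le_of_tendsto {f : ℕ → Ω → ℝ≥0∞} {g : Ω → ℝ≥0∞}
    (hf : ∀ n, AEMeasurable (f n) μ)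
    (hlim : ∀ᵐ ω ∂μ, Tendsto (fun n => f n ω) atTop (𝓝 (g ω))) {r : ℝ≥0∞}
    (hr : ∀ᶠ n in atTop, weightedNorm φ₀ (f n) ≤ r) : weightedNorm φ₀ g ≤ r := by
  refine weightedNorm_le_iff.2 fun Z hZ => ?_
  calc ∫⁻ ω, g ω * ‖(Z : Ω → ℝ) ω‖ₑ ∂μ
      = ∫⁻ ω, liminf (fun n => f n ω * ‖(Z : Ω → ℝ) ω‖ₑ) atTop ∂μ := by
        refine lintegral_congr_ae ?_
        filter_upwards [hlim] with ω hω
        exact (ENNReal.Tendsto.mul_const hω (.inr enorm_ne_top)).liminf_eq.symm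
    _ ≤ liminf (fun n => ∫⁻ ω, f n ω * ‖(Z : Ω → ℝ) ω‖ₑ ∂μ) atTop :=
        lintegral_liminf_le' fun n => aemeasurable_mul_enorm_coe (hf n) Z
    _ ≤ r * (1 + penalty φ₀ Z) := by
        refine liminf_le_of_le (by isBoundedDefault) fun b hb => ?_
        obtain ⟨n, h1, h2⟩ := (hb.and hr).exists
        exact h1.trans (weightedNorm_le_iff.1 h2 Z hZ)

/-- The weighted norm inherits the Lebesgue property. -/
lemma tendsto_weightedNorm [IsFiniteMeasure μ] (hmono : Monotone φ₀)
    (hLeb : HasLebesgueProperty φ₀) (hzero : φ₀ 0 = 0) {f : ℕ → Ω → ℝ≥0∞}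
    (hf : ∀ n, AEMeasurable (f n) μ) {C : ℝ≥0} (hC : ∀ n, ∀ᵐ ω ∂μ, f n ω ≤ C)
    (hlim : ∀ᵐ ω ∂μ, Tendsto (fun n => f n ω) atTop (𝓝 0)) :
    Tendsto (fun n => weightedNorm φ₀ (f n)) atTop (𝓝 0) := by
  refine ENNReal.tendsto_nhds_zero.2 fun ε hε => ?_
  obtain ⟨r, hr, hrε⟩ : ∃ r : ℝ≥0, 0 < r ∧ (r : ℝ≥0∞) ≤ ε := by
    obtain ⟨r, h1, h2⟩ := ENNReal.lt_iff_exists_nnreal_btwn.1 hε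
    exact ⟨r, by exact_mod_cast h1, h2.le⟩
  have hF (n : ℕ) : ∀ᵐ ω ∂μ, ‖(r : ℝ)⁻¹ * (f n ω).toReal‖ ≤ (r : ℝ)⁻¹ * C := by
    filter_upwards [hC n] with ω h
    rw [norm_mul, norm_inv, NNReal.norm_eq, Real.norm_of_nonneg ENNReal.toReal_nonneg]
    gcongr
    exact ENNReal.toReal_mono (by simp) h
  have hM (n : ℕ) : MemLp (fun ω => (r : ℝ)⁻¹ * (f n ω).toReal) ∞ μ :=
    memLp_top_of_bound ((hf n).ennreal_toReal.const_mul _).aestronglyMeasurable _ (hF n)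
  -- Once `φ₀ (f n / r) < 1`, Fenchel–Young gives `E[f n |Z|] ≤ r (1 + φ₀^*(Z))` for all `Z` at
  -- once, that is, norm at most `r`.
  have h := hLeb.tendsto_toLp hM (MemLp.zero (μ := μ) (p := ∞) (ε := ℝ)) (by positivity) hF (by
    filter_upwards [hlim] with ω h
    simpa using ((ENNReal.tendsto_toReal ENNReal.zero_ne_top).comp h).const_mul (r : ℝ)⁻¹)
  rw [MemLp.toLp_zero, hzero] at h
  filter_upwards [h.eventually (gt_mem_nhds one_pos)] with n hn
  refine le_trans ?_ hrε
  refine weightedNorm_le_iff.2 fun Z hZ => ?_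
  have hle := lintegral_le_add_penalty hzero hmono hZ (hM n)
    (ae_of_all _ fun ω => mul_nonneg (by positivity) ENNReal.toReal_nonneg)
  have hle1 : ENNReal.ofReal (φ₀ (hM n).toLp) ≤ 1 := by simpa using hn.le
  have hr0 : (r : ℝ≥0∞) ≠ 0 := by simpa using hr.ne'
  calc ∫⁻ ω, f n ω * ‖(Z : Ω → ℝ) ω‖ₑ ∂μ
      = r * ∫⁻ ω, ‖(r : ℝ)⁻¹ * (f n ω).toReal‖ₑ * ‖(Z : Ω → ℝ) ω‖ₑ ∂μ := by
        rw [← lintegral_const_mul' _ _ (by simp)]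
        refine lintegral_congr_ae ?_
        filter_upwards [hC n] with ω h
        rw [enorm_mul, enorm_inv (by simpa using hr.ne'), Real.enorm_of_nonneg (NNReal.coe_nonneg r),
          Real.enorm_of_nonneg ENNReal.toReal_nonneg,
          ENNReal.ofReal_toReal (h.trans_lt ENNReal.coe_lt_top).ne]
        rw [ENNReal.ofReal_coe_nnreal, mul_assoc, ENNReal.mul_inv_cancel_left hr0 (by simp)]
    _ ≤ r * (1 + penalty φ₀ Z) := by gcongr; exact hle.trans (by gcongr)

/-- The constants `C / (n + 1)` tend to `0` in norm, so one of them has finite norm; homogeneity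
does the rest. -/
lemma weightedNorm_const_lt_top [IsFiniteMeasure μ] (hmono : Monotone φ₀)
    (hLeb : HasLebesgueProperty φ₀) (hzero : φ₀ 0 = 0) (C : ℝ≥0) :
    weightedNorm φ₀ (fun _ => (C : ℝ≥0∞)) < ∞ := by
  have h := tendsto_weightedNorm hmono hLeb hzero
    (f := fun n _ => ((n : ℝ≥0∞) + 1)⁻¹ * C) (C := C) (fun n => aemeasurable_const)
    (fun n => ae_of_all _ fun _ => mul_le_of_le_one_left' (by simp)) (ae_of_all _ fun _ => by
      have : Tendsto (fun n : ℕ => ((n : ℝ≥0∞) + 1)⁻¹) atTop (𝓝 0) := by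
        simpa using (tendsto_add_atTop_iff_nat 1).2 ENNReal.tendsto_inv_nat_nhds_zero
      simpa using ENNReal.Tendsto.mul_const this (.inr (ENNReal.coe_ne_top (r := C))))
  obtain ⟨n, hn⟩ := (h.eventually (gt_mem_nhds ENNReal.zero_lt_top)).exists
  rw [weightedNorm_const_mul (by simp)] at hn
  refine lt_top_iff_ne_top.2 fun htop => ?_
  rw [htop, ENNReal.mul_top (by simp)] at hn
  exact hn.ne rfl

/-- Under sensitivity, every event of positive probability is charged by some `Z ∈ dom φ₀^*`. -/
lemma ae_of_forall_conjugate [IsFiniteMeasure μ] (hconv : ConvexOn ℝ Set.univ φ₀)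
    (hLeb : HasLebesgueProperty φ₀) (hzero : φ₀ 0 = 0) (hsens : IsSensitive φ₀)
    {A : Set Ω} (hA : MeasurableSet A)
    (h : ∀ Z : Lp ℝ 1 μ, conjugate φ₀ Z < ⊤ → ∀ᵐ ω ∂μ, ω ∈ A → (Z : Ω → ℝ) ω = 0) : μ A = 0 := by
  by_contra hne
  obtain ⟨ε, -, hpos⟩ := hsens A hA (pos_iff_ne_zero.2 hne)
  -- Any level strictly between `0` and `φ₀ (ε 1_A)` would do: a nonnegative penalty makes `E[ε 1_A
  -- Z]` positive, although `Z` vanishes on `A`.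
  obtain ⟨Z, hZ, hle⟩ := exists_lt_integral_sub_conjugate hconv hLeb hzero (half_lt_self hpos)
  have h0 : ∫ ω, (indicatorConstLp ∞ hA (measure_ne_top μ A) ε : Ω → ℝ) ω * (Z : Ω → ℝ) ω ∂μ
      = 0 := by
    refine integral_eq_zero_of_ae ?_
    filter_upwards [indicatorConstLp_coeFn (p := ∞) (hs := hA) (hμs := measure_ne_top μ A) (c := ε),
      h Z hZ] with ω h1 h2
    rw [h1]
    by_cases hω : ω ∈ A
    · simp [h2 hω]
    · simp [hω]
  have := EReal.toReal_nonneg (conjugate_nonneg hzero Z)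
  rw [h0] at hle
  linarith

/-- Each `E[f |Z|]` is finite, so every `Z` vanishes on `{f = ∞}`, and sensitivity makes this event
null. -/
lemma ae_lt_top_of_weightedNorm_ne_top [IsFiniteMeasure μ] (hconv : ConvexOn ℝ Set.univ φ₀)
    (hLeb : HasLebesgueProperty φ₀) (hzero : φ₀ 0 = 0) (hsens : IsSensitive φ₀)
    (hf : Measurable f) (h : weightedNorm φ₀ f ≠ ∞) : ∀ᵐ ω ∂μ, f ω < ∞ := by
  have := ae_of_forall_conjugate hconv hLeb hzero hsens (A := {ω | f ω = ∞})
    (hf (measurableSet_singleton _)) fun Z hZ => by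
      have hne : ∫⁻ ω, f ω * ‖(Z : Ω → ℝ) ω‖ₑ ∂μ ≠ ∞ :=
        ((lintegral_le_weightedNorm_mul f hZ).trans_lt (ENNReal.mul_lt_top h.lt_top
          (ENNReal.add_lt_top.2 ⟨by simp, (penalty_ne_top hZ).lt_top⟩))).ne
      filter_upwards [ae_lt_top' (aemeasurable_mul_enorm_coe hf.aemeasurable Z) hne] with ω h1 h2
      by_contra h3
      have h2 : f ω = ∞ := h2
      rw [h2, ENNReal.top_mul (by simpa using h3)] at h1
      exact h1.ne rfl
  filter_upwards [measure_eq_zero_iff_ae_notMem.1 this] with ω hω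
  exact lt_top_iff_ne_top.2 hω

/-- If `f` has norm `0`, so does `∞ * f`, which is therefore a.s. finite; this forces `f = 0`. -/
lemma ae_eq_zero_of_weightedNorm_eq_zero [IsFiniteMeasure μ] (hconv : ConvexOn ℝ Set.univ φ₀)
    (hLeb : HasLebesgueProperty φ₀) (hzero : φ₀ 0 = 0) (hsens : IsSensitive φ₀)
    (hf : Measurable f) (h : weightedNorm φ₀ f = 0) : ∀ᵐ ω ∂μ, f ω = 0 := by
  have := ae_lt_top_of_weightedNorm_ne_top hconv hLeb hzero hsens
    (f := fun ω => ∞ * f ω) (hf.const_mul _) (by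
      refine ne_top_of_le_ne_top ENNReal.zero_ne_top (weightedNorm_le_iff.2 fun Z hZ => ?_)
      have := lintegral_le_weightedNorm_mul f hZ
      rw [h] at this
      simp only [mul_assoc]
      rw [lintegral_const_mul'' _ (aemeasurable_mul_enorm_coe hf.aemeasurable Z)]
      rw [zero_mul, nonpos_iff_eq_zero] at this
      simp [this])
  filter_upwards [this] with ω hω
  by_contra h0
  rw [ENNReal.top_mul h0] at hω
  exact hω.ne rfl

end WeightedNorm

/-! ### The gauge as a weighted norm, and vanishing tails -/

section Gauge

variable {φ₀ : Lp ℝ ∞ μ → ℝ}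

lemma hatPhi_smul_le_iff [IsFiniteMeasure μ] (hmono : Monotone φ₀) (hzero : φ₀ 0 = 0) {α : ℝ≥0} {X : Ω →ₘ[μ] ℝ}
    (hX : 0 ≤ᵐ[μ] X) (a : ℝ≥0∞) :
    hatPhi φ₀ ((α : ℝ) • X) ≤ a ↔ ∀ Z : Lp ℝ 1 μ, conjugate φ₀ Z < ⊤ →
      α * ∫⁻ ω, ‖X ω‖ₑ * ‖(Z : Ω → ℝ) ω‖ₑ ∂μ ≤ a + penalty φ₀ Z := by
  rw [hatPhi_le_iff hmono hzero]
  · refine forall₂_congr fun Z hZ => ?_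
    rw [← lintegral_const_mul' _ _ (by simp)]
    have e : ∫⁻ ω, ‖((α : ℝ) • X) ω‖ₑ * ‖(Z : Ω → ℝ) ω‖ₑ ∂μ
        = ∫⁻ ω, α * (‖X ω‖ₑ * ‖(Z : Ω → ℝ) ω‖ₑ) ∂μ := by
      refine lintegral_congr_ae ?_
      filter_upwards [AEEqFun.coeFn_smul (α : ℝ) X] with ω h
      rw [h, Pi.smul_apply, smul_eq_mul, enorm_mul, Real.enorm_of_nonneg (NNReal.coe_nonneg α),
        ENNReal.ofReal_coe_nnreal, mul_assoc]
    rw [e]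
  · filter_upwards [hX, AEEqFun.coeFn_smul (α : ℝ) X] with ω h1 h2
    rw [h2]
    exact mul_nonneg (NNReal.coe_nonneg α) h1

lemma hatPhi_inv_smul_le_one_iff [IsFiniteMeasure μ] (hmono : Monotone φ₀) (hzero : φ₀ 0 = 0) {r : ℝ≥0} (hr : 0 < r)
    {X : Ω →ₘ[μ] ℝ} (hX : 0 ≤ᵐ[μ] X) :
    hatPhi φ₀ ((r : ℝ)⁻¹ • X) ≤ 1 ↔ weightedNorm φ₀ (fun ω => ‖X ω‖ₑ) ≤ r := by
  rw [← NNReal.coe_inv, ← EReal.coe_ennreal_one, hatPhi_smul_le_iff hmono hzero hX,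
    weightedNorm_le_iff]
  refine forall₂_congr fun Z hZ => ?_
  rw [ENNReal.coe_inv hr.ne', mul_comm, ← div_eq_mul_inv,
    ENNReal.div_le_iff (by simpa using hr.ne') (by simp), mul_comm]

lemma gaugeNorm_eq [IsFiniteMeasure μ] (hmono : Monotone φ₀) (hzero : φ₀ 0 = 0) (X : Ω →ₘ[μ] ℝ) :
    gaugeNorm φ₀ X = weightedNorm φ₀ (fun ω => ‖X ω‖ₑ) := by
  have hX : 0 ≤ᵐ[μ] (|X| : Ω →ₘ[μ] ℝ) := by
    filter_upwards [AEEqFun.coeFn_abs X] with ω h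
    rw [h]
    exact abs_nonneg _
  have e : weightedNorm φ₀ (fun ω => ‖X ω‖ₑ) =
      weightedNorm φ₀ (fun ω => ‖(|X| : Ω →ₘ[μ] ℝ) ω‖ₑ) := by
    refine weightedNorm_congr ?_
    filter_upwards [AEEqFun.coeFn_abs X] with ω h
    rw [h, Real.enorm_abs]
  rw [e]
  refine le_antisymm (le_of_forall_gt_imp_ge_of_dense fun a ha => ?_) ?_
  · obtain ⟨r, h1, h2⟩ := ENNReal.lt_iff_exists_nnreal_btwn.1 ha
    have hr : 0 < r := by exact_mod_cast (zero_le (a := weightedNorm φ₀ _)).trans_lt h1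
    exact (iInf₂_le_of_le r hr (iInf_le _
      ((hatPhi_inv_smul_le_one_iff hmono hzero hr hX).2 h1.le))).trans h2.le
  · exact le_iInf fun r => le_iInf₂ fun hr h => (hatPhi_inv_smul_le_one_iff hmono hzero hr hX).1 h

/-- The function `x ↦ x 1_{x > N}` on the extended nonnegative reals. -/
def tailPart (N : ℕ) (x : ℝ≥0∞) : ℝ≥0∞ := if (N : ℝ≥0∞) < x then x else 0

lemma measurable_tailPart (N : ℕ) : Measurable (tailPart N) :=
  Measurable.ite (measurableSet_lt measurable_const measurable_id) measurable_id measurable_const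

lemma tailPart_mono (N : ℕ) : Monotone (tailPart N) := by
  intro x y h
  unfold tailPart
  split_ifs with h1 h2
  · exact h
  · exact (h2 (h1.trans_le h)).elim
  · exact zero_le
  · exact le_rfl

lemma tailPart_le (N : ℕ) (x : ℝ≥0∞) : tailPart N x ≤ x := by
  unfold tailPart
  split_ifs
  · exact le_rfl
  · exact zero_le

lemma le_min_add_tailPart (N : ℕ) (x : ℝ≥0∞) : x ≤ min x N + tailPart N x := by
  unfold tailPart
  split_ifs with h
  · exact le_add_self
  · simp [not_lt.1 h]

lemma tailPart_le_two_mul {N : ℕ} {x y : ℝ≥0∞} (h : x ≤ 2 * y) :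
    tailPart N x ≤ 2 * tailPart (N / 2) y := by
  by_cases h1 : (N : ℝ≥0∞) < x
  · have h2 : ((N / 2 : ℕ) : ℝ≥0∞) < y := by
      refine (ENNReal.mul_lt_mul_iff_right (a := 2) (by simp) (by simp)).1 ?_
      refine lt_of_le_of_lt ?_ (h1.trans_le h)
      exact_mod_cast Nat.mul_div_le N 2
    simpa [tailPart, h1, h2] using h
  · simp [tailPart, h1]

/-- `tailPart N` is not subadditive: `y + z` may exceed `N` when neither term does. Since `y + z` is
at most twice the larger term, halving the level repairs this. -/
lemma tailPart_le_add {N : ℕ} {x y z : ℝ≥0∞} (h : x ≤ y + z) :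
    tailPart N x ≤ 2 * tailPart (N / 2) y + 2 * tailPart (N / 2) z := by
  rcases le_total y z with hyz | hyz
  · exact (tailPart_le_two_mul (h.trans (by rw [two_mul]; gcongr))).trans le_add_self
  · exact (tailPart_le_two_mul (h.trans (by rw [two_mul]; gcongr))).trans le_self_add

lemma coeFn_tail (N : ℕ) (X : Ω →ₘ[μ] ℝ) :
    tail N X =ᵐ[μ] fun ω => Set.indicator {y : ℝ | (N : ℝ) < |y|} (fun y => |y|) (X ω) :=
  AEEqFun.coeFn_compMeasurable _ _ X

lemma tail_nonneg (N : ℕ) (X : Ω →ₘ[μ] ℝ) : 0 ≤ᵐ[μ] tail N X := by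
  filter_upwards [coeFn_tail N X] with ω h
  rw [h]
  exact Set.indicator_nonneg (fun y _ => abs_nonneg y) _

lemma enorm_tail (N : ℕ) (X : Ω →ₘ[μ] ℝ) :
    (fun ω => ‖tail N X ω‖ₑ) =ᵐ[μ] fun ω => tailPart N ‖X ω‖ₑ := by
  filter_upwards [coeFn_tail N X] with ω h
  have e : (N : ℝ) < |X ω| ↔ (N : ℝ≥0∞) < ‖X ω‖ₑ := by
    rw [Real.enorm_eq_ofReal_abs, ENNReal.lt_ofReal_iff_toReal_lt (by simp)]
    simp
  rw [h, tailPart]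
  by_cases hN : (N : ℝ) < |X ω|
  · rw [Set.indicator_of_mem (by exact hN), if_pos (e.1 hN), Real.enorm_abs]
  · rw [Set.indicator_of_notMem (by exact hN), if_neg (mt e.2 hN), enorm_zero]

/-- The functions whose tails vanish in the weighted norm. -/
def TailVanishing (φ₀ : Lp ℝ ∞ μ → ℝ) (f : Ω → ℝ≥0∞) : Prop :=
  Tendsto (fun N => weightedNorm φ₀ (fun ω => tailPart N (f ω))) atTop (𝓝 0)

/-- Having every `α` available lets `α = 1/r` bring the norm of the tail below any `r`. -/
lemma mem_orliczU_iff [IsFiniteMeasure μ] (hmono : Monotone φ₀) (hconv : ConvexOn ℝ Set.univ φ₀)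
    (hLeb : HasLebesgueProperty φ₀) (hzero : φ₀ 0 = 0) {X : Ω →ₘ[μ] ℝ} :
    X ∈ orliczU φ₀ ↔ TailVanishing φ₀ (fun ω => ‖X ω‖ₑ) := by
  unfold TailVanishing
  simp_rw [← weightedNorm_congr (enorm_tail _ X)]
  constructor
  · intro h
    refine ENNReal.tendsto_nhds_zero.2 fun ε hε => ?_
    obtain ⟨r, h1, h2⟩ := ENNReal.lt_iff_exists_nnreal_btwn.1 hε
    have hr : 0 < r := by exact_mod_cast h1
    filter_upwards [(h (r : ℝ)⁻¹ (by positivity)).eventually (gt_mem_nhds zero_lt_one)] with N hN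
    exact ((hatPhi_inv_smul_le_one_iff hmono hzero hr (tail_nonneg N X)).1 hN.le).trans h2.le
  · intro h α hα
    lift α to ℝ≥0 using hα.le
    have hpos (N : ℕ) : 0 ≤ᵐ[μ] ((α : ℝ) • tail N X : Ω →ₘ[μ] ℝ) := by
      filter_upwards [tail_nonneg N X, AEEqFun.coeFn_smul (α : ℝ) (tail N X)] with ω h1 h2
      rw [h2]
      exact mul_nonneg hα.le h1
    refine tendsto_order.2 ⟨fun a ha => Eventually.of_forall fun N =>
      ha.trans_le (hatPhi_nonneg hmono hconv hLeb hzero (hpos N)), fun a ha => ?_⟩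
    obtain ⟨d, hd0, hda⟩ := EReal.lt_iff_exists_real_btwn.1 ha
    have hd0 : 0 < d := by exact_mod_cast hd0
    lift d to ℝ≥0 using hd0.le
    have hd0 : 0 < d := by exact_mod_cast hd0
    have hα' := ENNReal.Tendsto.const_mul h (.inr (ENNReal.coe_ne_top (r := α)))
    rw [mul_zero] at hα'
    -- The bound `d` controls the value of `φ̂`; the bound `1` keeps the coefficient of the penalty
    -- at most `1`, so that it is absorbed.
    have hm : (0 : ℝ≥0∞) < (min d 1 : ℝ≥0) := by simpa using hd0
    filter_upwards [hα'.eventually (gt_mem_nhds hm)] with N hN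
    refine lt_of_le_of_lt ?_ hda
    refine (hatPhi_smul_le_iff hmono hzero (tail_nonneg N X) (d : ℝ≥0∞)).2 fun Z hZ => ?_
    calc α * ∫⁻ ω, ‖tail N X ω‖ₑ * ‖(Z : Ω → ℝ) ω‖ₑ ∂μ
        ≤ α * (weightedNorm φ₀ (fun ω => ‖tail N X ω‖ₑ) * (1 + penalty φ₀ Z)) := by
          gcongr; exact lintegral_le_weightedNorm_mul _ hZ
      _ ≤ (min d 1 : ℝ≥0) * (1 + penalty φ₀ Z) := by
          rw [← mul_assoc]; gcongr
      _ ≤ d + penalty φ₀ Z := by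
          rw [mul_add, mul_one]
          gcongr
          · exact min_le_left _ _
          · exact mul_le_of_le_one_left' (by exact_mod_cast min_le_right _ _)

variable {f g h : Ω → ℝ≥0∞}

lemma TailVanishing.mono (hg : TailVanishing φ₀ g) (hfg : f ≤ᵐ[μ] g) : TailVanishing φ₀ f :=
  tendsto_of_tendsto_of_tendsto_of_le_of_le tendsto_const_nhds hg (fun _ => zero_le) fun N => by
    refine weightedNorm_mono ?_
    filter_upwards [hfg] with ω hω using tailPart_mono N hω

lemma weightedNorm_tailPart_le (hg : AEMeasurable g μ) (hfgh : ∀ᵐ ω ∂μ, f ω ≤ g ω + h ω) (N : ℕ) :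
    weightedNorm φ₀ (fun ω => tailPart N (f ω)) ≤
      2 * weightedNorm φ₀ (fun ω => tailPart (N / 2) (g ω)) +
      2 * weightedNorm φ₀ (fun ω => tailPart (N / 2) (h ω)) := by
  rw [← weightedNorm_const_mul (by simp), ← weightedNorm_const_mul (by simp)]
  refine le_trans (weightedNorm_mono ?_) (weightedNorm_add_le
    (((measurable_tailPart _).comp_aemeasurable hg).const_mul _) _)
  filter_upwards [hfgh] with ω hω using tailPart_le_add hω

lemma TailVanishing.comp_div_two (hf : TailVanishing φ₀ f) :
    Tendsto (fun N : ℕ => 2 * weightedNorm φ₀ (fun ω => tailPart (N / 2) (f ω))) atTop (𝓝 0) := by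
  have := ENNReal.Tendsto.const_mul (hf.comp (Nat.tendsto_div_const_atTop two_ne_zero))
    (.inr (ENNReal.ofNat_ne_top (n := 2)))
  simpa using this

lemma TailVanishing.of_le_add (hgm : AEMeasurable g μ) (hg : TailVanishing φ₀ g)
    (hh : TailVanishing φ₀ h) (hfgh : ∀ᵐ ω ∂μ, f ω ≤ g ω + h ω) : TailVanishing φ₀ f := by
  have := hg.comp_div_two.add hh.comp_div_two
  rw [add_zero] at this
  exact tendsto_of_tendsto_of_tendsto_of_le_of_le tendsto_const_nhds this (fun _ => zero_le)
    (weightedNorm_tailPart_le hgm hfgh)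

/-- This closedness under norm limits puts the limit of a Cauchy sequence in the space. -/
lemma TailVanishing.of_approx (H : ∀ ε : ℝ≥0∞, 0 < ε → ∃ g h : Ω → ℝ≥0∞, AEMeasurable g μ ∧
    TailVanishing φ₀ g ∧ weightedNorm φ₀ h ≤ ε ∧ ∀ᵐ ω ∂μ, f ω ≤ g ω + h ω) :
    TailVanishing φ₀ f := by
  refine ENNReal.tendsto_nhds_zero.2 fun ε hε => ?_
  have hε4 : 0 < ε / 2 / 2 := ENNReal.half_pos (ENNReal.half_pos hε.ne').ne'
  obtain ⟨g, h, hgm, hg, hh, hle⟩ := H _ hε4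
  filter_upwards [ENNReal.tendsto_nhds_zero.1 hg.comp_div_two _ (ENNReal.half_pos hε.ne')]
    with N hN
  calc _ ≤ _ := weightedNorm_tailPart_le hgm hle N
    _ ≤ ε / 2 + 2 * (ε / 2 / 2) := by
        gcongr
        exact (weightedNorm_mono (ae_of_all _ fun ω => tailPart_le _ _)).trans hh
    _ = ε := by rw [ENNReal.mul_div_cancel (by simp) (by simp), ENNReal.add_halves]

lemma weightedNorm_le_min_add (hf : AEMeasurable f μ) (N : ℕ) :
    weightedNorm φ₀ f ≤
      weightedNorm φ₀ (fun ω => min (f ω) N) + weightedNorm φ₀ (fun ω => tailPart N (f ω)) :=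
  (weightedNorm_mono (ae_of_all _ fun ω => le_min_add_tailPart N (f ω))).trans
    (weightedNorm_add_le (hf.min aemeasurable_const) _)

lemma TailVanishing.weightedNorm_lt_top [IsFiniteMeasure μ] (hmono : Monotone φ₀) (hLeb : HasLebesgueProperty φ₀)
    (hzero : φ₀ 0 = 0) (hfm : AEMeasurable f μ) (hf : TailVanishing φ₀ f) :
    weightedNorm φ₀ f < ∞ := by
  obtain ⟨N, hN⟩ := (hf.eventually (gt_mem_nhds ENNReal.zero_lt_top)).exists
  refine (weightedNorm_le_min_add hfm N).trans_lt (ENNReal.add_lt_top.2 ⟨?_, hN⟩)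
  exact (weightedNorm_mono (ae_of_all _ fun ω => min_le_right _ _)).trans_lt
    (by simpa using weightedNorm_const_lt_top hmono hLeb hzero (N : ℝ≥0))

lemma TailVanishing.tendsto_weightedNorm [IsFiniteMeasure μ] (hmono : Monotone φ₀) (hLeb : HasLebesgueProperty φ₀)
    (hzero : φ₀ 0 = 0) {f : ℕ → Ω → ℝ≥0∞} (hfm : ∀ n, AEMeasurable (f n) μ)
    (hg : TailVanishing φ₀ g) (hfg : ∀ n, f n ≤ᵐ[μ] g)
    (hlim : ∀ᵐ ω ∂μ, Tendsto (fun n => f n ω) atTop (𝓝 0)) :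
    Tendsto (fun n => weightedNorm φ₀ (f n)) atTop (𝓝 0) := by
  refine ENNReal.tendsto_nhds_zero.2 fun ε hε => ?_
  have hε2 := ENNReal.half_pos hε.ne'
  -- The level is chosen from the dominating `g`, hence uniformly in `n`; the Lebesgue property
  -- handles the truncations at `N`.
  obtain ⟨N, hN⟩ := (ENNReal.tendsto_nhds_zero.1 hg _ hε2).exists
  have := LebesgueExtension.tendsto_weightedNorm hmono hLeb hzero
    (f := fun n ω => min (f n ω) N) (C := N) (fun n => (hfm n).min aemeasurable_const)
    (fun n => ae_of_all _ fun ω => by simp) (by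
      filter_upwards [hlim] with ω hω
      exact tendsto_of_tendsto_of_tendsto_of_le_of_le tendsto_const_nhds hω
        (fun _ => zero_le) fun n => min_le_left _ _)
  filter_upwards [ENNReal.tendsto_nhds_zero.1 this _ hε2] with n hn
  refine (weightedNorm_le_min_add (hfm n) N).trans ?_
  rw [← ENNReal.add_halves ε]
  refine add_le_add hn (le_trans (weightedNorm_mono ?_) hN)
  filter_upwards [hfg n] with ω hω using tailPart_mono N hω

end Gauge

/-! ### The Banach lattice structure and order continuity -/

section Lattice

lemma aemeasurable_enorm_aeeqFun (X : Ω →ₘ[μ] ℝ) : AEMeasurable (fun ω => ‖X ω‖ₑ) μ :=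
  X.measurable.enorm.aemeasurable

lemma abs_aeeqFun_of_nonneg {X : Ω →ₘ[μ] ℝ} (h : 0 ≤ X) : |X| = X := by
  refine AEEqFun.ext ?_
  filter_upwards [AEEqFun.coeFn_le.2 h, AEEqFun.coeFn_abs X,
    AEEqFun.coeFn_zero (α := Ω) (β := ℝ) (μ := μ)] with ω h1 h2 h3
  rw [h3] at h1
  rw [h2]
  exact abs_of_nonneg h1

lemma ae_enorm_le_of_abs_le {X Y : Ω →ₘ[μ] ℝ} (h : |X| ≤ |Y|) :
    (fun ω => ‖X ω‖ₑ) ≤ᵐ[μ] fun ω => ‖Y ω‖ₑ := by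
  filter_upwards [AEEqFun.coeFn_le.2 h, AEEqFun.coeFn_abs X, AEEqFun.coeFn_abs Y] with ω h1 h2 h3
  rw [h2, h3] at h1
  simp only [Real.enorm_eq_ofReal_abs]
  exact ENNReal.ofReal_le_ofReal h1

lemma ae_enorm_le_of_abs_le_self {X Y : Ω →ₘ[μ] ℝ} (h : |X| ≤ Y) :
    (fun ω => ‖X ω‖ₑ) ≤ᵐ[μ] fun ω => ‖Y ω‖ₑ :=
  ae_enorm_le_of_abs_le (h.trans (le_abs_self Y))

lemma ae_enorm_add_le (X Y : Ω →ₘ[μ] ℝ) :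
    ∀ᵐ ω ∂μ, ‖(X + Y) ω‖ₑ ≤ ‖X ω‖ₑ + ‖Y ω‖ₑ := by
  filter_upwards [AEEqFun.coeFn_add X Y] with ω h
  rw [h]
  exact enorm_add_le _ _

lemma ae_enorm_smul (c : ℝ) (X : Ω →ₘ[μ] ℝ) :
    (fun ω => ‖(c • X) ω‖ₑ) =ᵐ[μ] fun ω => ENNReal.ofReal |c| * ‖X ω‖ₑ := by
  filter_upwards [AEEqFun.coeFn_smul c X] with ω h
  rw [h, Pi.smul_apply, smul_eq_mul, enorm_mul, Real.enorm_eq_ofReal_abs c]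

lemma ae_enorm_sub (X Y : Ω →ₘ[μ] ℝ) :
    (fun ω => ‖(X - Y) ω‖ₑ) =ᵐ[μ] fun ω => ‖X ω - Y ω‖ₑ := by
  filter_upwards [AEEqFun.coeFn_sub X Y] with ω h
  rw [h, Pi.sub_apply]

variable [IsFiniteMeasure μ] {φ₀ : Lp ℝ ∞ μ → ℝ}

lemma isSolidSubspace_orliczU (hmono : Monotone φ₀) (hconv : ConvexOn ℝ Set.univ φ₀)
    (hLeb : HasLebesgueProperty φ₀) (hzero : φ₀ 0 = 0) : IsSolidSubspace (orliczU φ₀) := by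
  have mem (X : Ω →ₘ[μ] ℝ) := mem_orliczU_iff hmono hconv hLeb hzero (X := X)
  have solid : ∀ (X : Ω →ₘ[μ] ℝ), ∀ Y ∈ orliczU φ₀, |X| ≤ |Y| → X ∈ orliczU φ₀ := fun X Y hY h =>
    (mem X).2 (((mem Y).1 hY).mono (ae_enorm_le_of_abs_le h))
  have zero_mem : (0 : Ω →ₘ[μ] ℝ) ∈ orliczU φ₀ := by
    refine (mem 0).2 (TailVanishing.mono (g := fun _ => 0) ?_ ?_)
    · have (N : ℕ) : tailPart N 0 = 0 := by simp [tailPart]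
      simp [TailVanishing, this]
    · filter_upwards [AEEqFun.coeFn_zero (α := Ω) (β := ℝ) (μ := μ)] with ω h
      simp [h]
  have add_mem : ∀ X ∈ orliczU φ₀, ∀ Y ∈ orliczU φ₀, X + Y ∈ orliczU φ₀ := fun X hX Y hY =>
    (mem _).2 (TailVanishing.of_le_add (aemeasurable_enorm_aeeqFun X) ((mem X).1 hX)
      ((mem Y).1 hY) (ae_enorm_add_le X Y))
  refine ⟨zero_mem, add_mem, fun c X hX => ?_, solid⟩
  -- Integer multiples come from additivity, and solidity then covers `c • X` through `|c| ≤ n`.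
  have hnsmul (n : ℕ) : n • X ∈ orliczU φ₀ := by
    induction n with
    | zero => simpa using zero_mem
    | succ n ih => rw [succ_nsmul]; exact add_mem _ ih _ hX
  obtain ⟨n, hn⟩ := exists_nat_ge |c|
  refine solid _ _ (hnsmul n) ?_
  rw [← AEEqFun.coeFn_le, ← Nat.cast_smul_eq_nsmul ℝ]
  filter_upwards [AEEqFun.coeFn_abs (c • X), AEEqFun.coeFn_abs ((n : ℝ) • X),
    AEEqFun.coeFn_smul c X, AEEqFun.coeFn_smul (n : ℝ) X] with ω h1 h2 h3 h4
  rw [h1, h2, h3, h4, Pi.smul_apply, Pi.smul_apply, smul_eq_mul, smul_eq_mul, abs_mul, abs_mul,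
    Nat.abs_cast]
  gcongr

lemma isLatticeNormOn_gaugeNorm (hmono : Monotone φ₀) (hconv : ConvexOn ℝ Set.univ φ₀)
    (hLeb : HasLebesgueProperty φ₀) (hzero : φ₀ 0 = 0) (hsens : IsSensitive φ₀) :
    IsLatticeNormOn (orliczU φ₀) (gaugeNorm φ₀) := by
  have norm_eq := gaugeNorm_eq (φ₀ := φ₀) hmono hzero
  constructor
  · intro X hX
    rw [norm_eq]
    exact ((mem_orliczU_iff hmono hconv hLeb hzero).1 hX).weightedNorm_lt_top hmono hLeb hzero
      (aemeasurable_enorm_aeeqFun X)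
  · intro X _
    rw [norm_eq]
    constructor
    · intro h
      refine AEEqFun.ext ?_
      filter_upwards [ae_eq_zero_of_weightedNorm_eq_zero hconv hLeb hzero hsens
        X.measurable.enorm h, AEEqFun.coeFn_zero (α := Ω) (β := ℝ) (μ := μ)] with ω h1 h2
      rw [h2]
      simpa using h1
    · rintro rfl
      rw [weightedNorm_congr (g := fun _ => 0), weightedNorm_zero]
      filter_upwards [AEEqFun.coeFn_zero (α := Ω) (β := ℝ) (μ := μ)] with ω h
      simp [h]
  · intro c X _
    rw [norm_eq, norm_eq, weightedNorm_congr (ae_enorm_smul c X),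
      weightedNorm_const_mul ENNReal.ofReal_ne_top]
  · intro X _ Y _
    rw [norm_eq, norm_eq, norm_eq]
    exact (weightedNorm_mono (ae_enorm_add_le X Y)).trans
      (weightedNorm_add_le (aemeasurable_enorm_aeeqFun X) _)
  · intro X _ Y _ h
    rw [norm_eq, norm_eq]
    exact weightedNorm_mono (ae_enorm_le_of_abs_le h)

lemma isCompleteFor_gaugeNorm (hmono : Monotone φ₀) (hconv : ConvexOn ℝ Set.univ φ₀)
    (hLeb : HasLebesgueProperty φ₀) (hzero : φ₀ 0 = 0) (hsens : IsSensitive φ₀) :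
    IsCompleteFor (orliczU φ₀) (gaugeNorm φ₀) := by
  intro X hX hC
  have norm_eq (X Y : Ω →ₘ[μ] ℝ) :
      gaugeNorm φ₀ (X - Y) = weightedNorm φ₀ (fun ω => ‖X ω - Y ω‖ₑ) := by
    rw [gaugeNorm_eq hmono hzero, weightedNorm_congr (ae_enorm_sub X Y)]
  simp_rw [norm_eq] at hC ⊢
  have hm (n m : ℕ) : Measurable fun ω => ‖X n ω - X m ω‖ₑ :=
    ((X n).measurable.sub (X m).measurable).enorm
  obtain ⟨k, hk, hkC⟩ := extraction_forall_of_eventually'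
    (P := fun j n => ∀ m ≥ n, weightedNorm φ₀ (fun ω => ‖X n ω - X m ω‖ₑ) ≤ (1 / 2) ^ j)
    (fun j => by
      obtain ⟨n₀, h⟩ := hC ((1 / 2) ^ j) (ENNReal.pow_pos (by simp) j)
      exact ⟨n₀, fun n hn m hm => (h n hn m (hn.le.trans hm)).le⟩)
  -- The increments of the fast subsequence have summable norms, so their sum has finite norm and,
  -- by sensitivity, is a.s. finite. The subsequence is thus a.s. Cauchy.
  have hS : weightedNorm φ₀ (fun ω => ∑' j, ‖X (k j) ω - X (k (j + 1)) ω‖ₑ) ≠ ∞ := by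
    refine ne_top_of_le_ne_top ?_ ((weightedNorm_tsum_le fun j => (hm _ _).aemeasurable).trans
      (ENNReal.tsum_le_tsum fun j => hkC j (k (j + 1)) (hk.monotone (Nat.le_succ j))))
    rw [ENNReal.tsum_geometric]
    simp
  have hlim : ∀ᵐ ω ∂μ, ∃ y, Tendsto (fun j => X (k j) ω) atTop (𝓝 y) := by
    filter_upwards [ae_lt_top_of_weightedNorm_ne_top hconv hLeb hzero hsens
      (Measurable.tsum fun j => hm _ _) hS] with ω hω
    refine cauchySeq_tendsto_of_complete (cauchySeq_of_edist_le_of_tsum_ne_top _ (fun j => ?_) hω.ne)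
    rw [edist_eq_enorm_sub]
  obtain ⟨y, hym, hy⟩ := measurable_limit_of_tendsto_metrizable_ae
    (fun j => (X (k j)).measurable.aemeasurable) hlim
  let Y : Ω →ₘ[μ] ℝ := AEEqFun.mk y hym.aestronglyMeasurable
  have hY : Y =ᵐ[μ] y := AEEqFun.coeFn_mk y _
  have hconvY (ε : ℝ≥0∞) (hε : 0 < ε) : ∃ n₀, ∀ n ≥ n₀,
      weightedNorm φ₀ (fun ω => ‖X n ω - Y ω‖ₑ) ≤ ε := by
    obtain ⟨n₀, h⟩ := hC ε hε
    refine ⟨n₀, fun n hn => weightedNorm_le_of_tendsto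
      (f := fun j ω => ‖X n ω - X (k j) ω‖ₑ) (fun j => (hm _ _).aemeasurable) ?_ ?_⟩
    · filter_upwards [hy, hY] with ω h1 h2
      rw [h2]
      exact (tendsto_const_nhds.sub h1).enorm
    · filter_upwards [hk.tendsto_atTop.eventually_ge_atTop n₀] with j hj
      exact (h n hn _ hj).le
  refine ⟨Y, (mem_orliczU_iff hmono hconv hLeb hzero).2 (TailVanishing.of_approx fun ε hε => ?_),
    ENNReal.tendsto_nhds_zero.2 fun ε hε => eventually_atTop.2 (hconvY ε hε)⟩
  obtain ⟨n, h⟩ := hconvY ε hε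
  refine ⟨_, _, aemeasurable_enorm_aeeqFun (X n),
    (mem_orliczU_iff hmono hconv hLeb hzero).1 (hX n), h n le_rfl, ae_of_all _ fun ω => ?_⟩
  calc ‖Y ω‖ₑ = ‖X n ω - (X n ω - Y ω)‖ₑ := by rw [sub_sub_cancel]
    _ ≤ _ := enorm_sub_le

lemma isSeqOrderContinuousOn_gaugeNorm (hmono : Monotone φ₀) (hconv : ConvexOn ℝ Set.univ φ₀)
    (hLeb : HasLebesgueProperty φ₀) (hzero : φ₀ 0 = 0) :
    IsSeqOrderContinuousOn (orliczU φ₀) (gaugeNorm φ₀) := by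
  intro X Y hY _ hXY hlim
  simp_rw [gaugeNorm_eq hmono hzero]
  refine TailVanishing.tendsto_weightedNorm hmono hLeb hzero
    (fun n => aemeasurable_enorm_aeeqFun (X n)) ((mem_orliczU_iff hmono hconv hLeb hzero).1 hY)
    (fun n => ae_enorm_le_of_abs_le_self (hXY n)) ?_
  filter_upwards [hlim] with ω hω
  simpa using hω.enorm

/-- A downward directed family of nonnegative random variables has a decreasing sequence converging
almost surely to a lower bound of the family. -/
lemma exists_antitone_tendsto_lowerBound {D : Set (Ω →ₘ[μ] ℝ)} (hne : D.Nonempty)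
    (hdir : DirectedOn (fun X Y => Y ≤ X) D) (hpos : ∀ X ∈ D, 0 ≤ X) :
    ∃ (V : ℕ → Ω →ₘ[μ] ℝ) (Y : Ω →ₘ[μ] ℝ), (∀ n, V n ∈ D) ∧ Antitone V ∧ 0 ≤ Y ∧
      (∀ n, Y ≤ V n) ∧ (∀ X ∈ D, Y ≤ X) ∧
      ∀ᵐ ω ∂μ, Tendsto (fun n => V n ω) atTop (𝓝 (Y ω)) := by
  have hbd (f : Ω → ℝ) (ω : Ω) : ‖Real.arctan (f ω)‖ ≤ Real.pi / 2 := by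
    rw [Real.norm_eq_abs, abs_le]
    exact ⟨(Real.neg_pi_div_two_lt_arctan _).le, (Real.arctan_lt_pi_div_two _).le⟩
  have hint (X : Ω →ₘ[μ] ℝ) : Integrable (fun ω => Real.arctan (X ω)) μ :=
    Integrable.of_bound (Real.measurable_arctan.comp X.measurable).aestronglyMeasurable (Real.pi / 2)
      (ae_of_all _ (hbd X))
  -- `J` is finite on all of `L^0` and strictly increasing, so a sequence minimizing `J` over `D`
  -- detects the infimum of `D`.
  let J : (Ω →ₘ[μ] ℝ) → ℝ := fun X => ∫ ω, Real.arctan (X ω) ∂μ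
  have J_mono : Monotone J := fun X Y h => by
    refine integral_mono_ae (hint X) (hint Y) ?_
    filter_upwards [AEEqFun.coeFn_le.2 h] with ω hω using Real.arctan_mono hω
  have J_tendsto {V : ℕ → Ω →ₘ[μ] ℝ} {Y : Ω →ₘ[μ] ℝ}
      (h : ∀ᵐ ω ∂μ, Tendsto (fun n => V n ω) atTop (𝓝 (Y ω))) :
      Tendsto (fun n => J (V n)) atTop (𝓝 (J Y)) := by
    refine tendsto_integral_of_dominated_convergence (fun _ => Real.pi / 2) (fun n => (hint _).1)
      (integrable_const _) (fun n => ae_of_all _ (hbd _)) ?_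
    filter_upwards [h] with ω hω using (Real.continuous_arctan.tendsto _).comp hω
  have hbdd : BddBelow (J '' D) := ⟨J 0, by
    rintro _ ⟨X, hX, rfl⟩
    exact J_mono (hpos X hX)⟩
  have hinf {X : Ω →ₘ[μ] ℝ} (hX : X ∈ D) : sInf (J '' D) ≤ J X := csInf_le hbdd ⟨X, hX, rfl⟩
  obtain ⟨u, -, hu, huD⟩ := exists_seq_tendsto_sInf (hne.image J) hbdd
  choose U hUD hU using huD
  choose! inf hinfD hinf_left hinf_right using hdir
  let V : ℕ → Ω →ₘ[μ] ℝ := fun n => Nat.rec (U 0) (fun n W => inf W (U (n + 1))) n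
  have hVD (n : ℕ) : V n ∈ D := by
    induction n with
    | zero => exact hUD 0
    | succ n ih => exact hinfD _ ih _ (hUD _)
  have hV : Antitone V := antitone_nat_of_succ_le fun n => hinf_left _ (hVD n) _ (hUD _)
  have hVU (n : ℕ) : V n ≤ U n := by
    cases n with
    | zero => exact le_rfl
    | succ n => exact hinf_right _ (hVD n) _ (hUD _)
  have hVJ : Tendsto (fun n => J (V n)) atTop (𝓝 (sInf (J '' D))) :=
    tendsto_of_tendsto_of_tendsto_of_le_of_le tendsto_const_nhds hu (fun n => hinf (hVD n))
      fun n => (J_mono (hVU n)).trans_eq (hU n)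
  have hV0 : ∀ᵐ ω ∂μ, ∀ n, 0 ≤ V n ω := ae_all_iff.2 fun n => by
    filter_upwards [AEEqFun.coeFn_le.2 (hpos _ (hVD n)),
      AEEqFun.coeFn_zero (α := Ω) (β := ℝ) (μ := μ)] with ω h1 h2
    rwa [h2] at h1
  have hVanti : ∀ᵐ ω ∂μ, Antitone fun n => V n ω := by
    filter_upwards [ae_all_iff.2 fun n => AEEqFun.coeFn_le.2 (hV (Nat.le_succ n))] with ω hω
      using antitone_nat_of_succ_le hω
  obtain ⟨y, hym, hy⟩ := measurable_limit_of_tendsto_metrizable_ae (L := atTop) (μ := μ)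
    (f := fun n ω => V n ω) (fun n => (V n).measurable.aemeasurable) (by
      filter_upwards [hV0, hVanti] with ω h1 h2
      exact ⟨_, tendsto_atTop_ciInf h2 ⟨0, by rintro _ ⟨n, rfl⟩; exact h1 n⟩⟩)
  let Y : Ω →ₘ[μ] ℝ := AEEqFun.mk y hym.aestronglyMeasurable
  have hlim : ∀ᵐ ω ∂μ, Tendsto (fun n => V n ω) atTop (𝓝 (Y ω)) := by
    filter_upwards [hy, AEEqFun.coeFn_mk y hym.aestronglyMeasurable] with ω h1 h2
    rwa [h2]
  refine ⟨V, Y, hVD, hV, ?_, fun n => ?_, fun X hX => ?_, hlim⟩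
  · rw [← AEEqFun.coeFn_le]
    filter_upwards [hV0, hlim, AEEqFun.coeFn_zero (α := Ω) (β := ℝ) (μ := μ)] with ω h1 h2 h3
    rw [h3]
    exact ge_of_tendsto' h2 h1
  · rw [← AEEqFun.coeFn_le]
    filter_upwards [hVanti, hlim] with ω h1 h2 using h1.le_of_tendsto h2 n
  · have hJY : J Y = sInf (J '' D) := tendsto_nhds_unique (J_tendsto hlim) hVJ
    -- Each `V n ⊓ X` dominates an element of `D`, so its `J` is at least the infimum, and so is
    -- that of the limit `Y ⊓ X`. Strict monotonicity then forces `Y ⊓ X = Y`.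
    have hle : J Y ≤ J (Y ⊓ X) := by
      rw [hJY]
      refine ge_of_tendsto' (J_tendsto (V := fun n => V n ⊓ X) ?_) fun n =>
        (hinf (hinfD _ (hVD n) _ hX)).trans
          (J_mono (le_inf (hinf_left _ (hVD n) _ hX) (hinf_right _ (hVD n) _ hX)))
      filter_upwards [hlim, AEEqFun.coeFn_inf Y X,
        ae_all_iff.2 fun n => AEEqFun.coeFn_inf (V n) X] with ω h1 h2 h3
      simp only [h2, h3]
      exact h1.min tendsto_const_nhds
    have hae := (integral_eq_iff_of_ae_le (hint (Y ⊓ X)) (hint Y) (by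
      filter_upwards [AEEqFun.coeFn_le.2 (inf_le_left : Y ⊓ X ≤ Y)] with ω hω
        using Real.arctan_mono hω)).1 (le_antisymm (J_mono inf_le_left) hle)
    rw [← AEEqFun.coeFn_le]
    filter_upwards [hae, AEEqFun.coeFn_inf Y X] with ω h1 h2
    have h3 := Real.arctan_injective h1
    rw [h2] at h3
    exact inf_eq_left.1 h3

/-- Solidity places the limit of a minimizing sequence in `M_u`, where the infimum hypothesis makes
it `0`; sequential order continuity then applies. -/
lemma isOrderContinuousOn_gaugeNorm (hmono : Monotone φ₀) (hconv : ConvexOn ℝ Set.univ φ₀)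
    (hLeb : HasLebesgueProperty φ₀) (hzero : φ₀ 0 = 0) :
    IsOrderContinuousOn (orliczU φ₀) (gaugeNorm φ₀) := by
  intro D hDE hne hdir hpos hglb
  obtain ⟨V, Y, hVD, hV, hY0, hYV, hYD, hlim⟩ := exists_antitone_tendsto_lowerBound hne hdir hpos
  have hYE : Y ∈ orliczU φ₀ :=
    (isSolidSubspace_orliczU hmono hconv hLeb hzero).solid Y _ (hDE (hVD 0))
      (by rw [abs_aeeqFun_of_nonneg hY0, abs_aeeqFun_of_nonneg (hpos _ (hVD 0))]; exact hYV 0)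
  have hY : Y = 0 := le_antisymm (hglb Y hYE hYD) hY0
  have htend := isSeqOrderContinuousOn_gaugeNorm hmono hconv hLeb hzero V (V 0) (hDE (hVD 0))
    (fun n => hDE (hVD n))
    (fun n => by rw [abs_aeeqFun_of_nonneg (hpos _ (hVD n))]; exact hV (Nat.zero_le n)) (by
      filter_upwards [hlim, AEEqFun.coeFn_zero (α := Ω) (β := ℝ) (μ := μ)] with ω h1 h2
      rw [hY, h2] at h1
      exact h1)
  exact le_antisymm (ge_of_tendsto' htend fun n => iInf₂_le (V n) (hVD n)) zero_le

end Lattice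

end LebesgueExtension

end

theorem mainTheorem11 {Ω : Type*} [MeasurableSpace Ω] (μ : Measure Ω) [IsProbabilityMeasure μ]
    (φ₀ : Lp ℝ ∞ μ → ℝ)
    (hmono : Monotone φ₀)
    (hconv : ConvexOn ℝ Set.univ φ₀)
    (hLeb : LebesgueExtension.HasLebesgueProperty φ₀)
    (hzero : φ₀ 0 = 0)
    (hsens : LebesgueExtension.IsSensitive φ₀) :
    LebesgueExtension.IsOrderContinuousBanachLattice
      (LebesgueExtension.orliczU φ₀) (LebesgueExtension.gaugeNorm φ₀) where
  solidSubspace := LebesgueExtension.isSolidSubspace_orliczU hmono hconv hLeb hzero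
  latticeNorm := LebesgueExtension.isLatticeNormOn_gaugeNorm hmono hconv hLeb hzero hsens
  complete := LebesgueExtension.isCompleteFor_gaugeNorm hmono hconv hLeb hzero hsens
  seqOrderContinuous :=
    LebesgueExtension.isSeqOrderContinuousOn_gaugeNorm hmono hconv hLeb hzero
  orderContinuous := LebesgueExtension.isOrderContinuousOn_gaugeNorm hmono hconv hLeb hzero
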